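/- Let $\mathbb{R}^N$ be equipped with the standard inner product $\langle\cdot,\cdot\rangle$. For $h:\mathbb{R}^N\to\mathbb{R}\cup\{\infty\}$ write $\operatorname{dom}(h)=\{x: h(x)<\infty\}$. Let $f:\mathbb{R}^N\to\mathbb{R}\cup\{\infty\}$ be a standard self-concordant function, i.e. $f$ is closed and convex with open domain, is three times continuously differentiable in $\operatorname{dom}(f)$, and for all $x\in\operatorname{dom}(f)$ and $u\in\mathbb{R}^N$ the function $\psi(t)=f(x+tu)$ satisfies $|\psi'''(0)|\le 2\,\psi''(0)^{3/2}$. Let $g:\mathbb{R}^N\to\mathbb{R}\cup\{\infty\}$ be a proper closed convex function, and let $F=f+g$. Assume that $\nabla^2 f(x)$ is positive definite for every $x\in\operatorname{dom}(F)$ and that $\min_x F(x)$ has a unique optimal solution. Let $F^*=\min_x F(x)$, let $x^0\in\operatorname{dom}(F)$ and let $\mathcal{S}(x^0)=\{x: F(x)\le F(x^0)\}$. A method generating a sequence $\{x^k\}$ from $x^0$ is called globally linearly convergent if there exists $q\in(0,1)$ such that $$F(x^k)-F^*\le q^k\,(F(x^0)-F^*)\qquad\text{for all } k\ge 0 .$$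 (a) Suppose that $g$ is Lipschitz differentiable in $\mathcal{S}(x^0)$, i.e. $g$ is finite in a neighbourhood of, and differentiable at, every point of $\mathcal{S}(x^0)$, and $\nabla g$ is Lipschitz continuous on $\mathcal{S}(x^0)$. Then the proximal damped Newton method $$d^k=\arg\min_{d}\Big\{f(x^k)+\langle\nabla f(x^k),d\rangle+\tfrac12\langle d,\nabla^2 f(x^k)d\rangle+g(x^k+d)\Big\},\qquad \lambda_k=\sqrt{\langle d^k,\nabla^2 f(x^k)d^k\rangle},\qquad x^{k+1}=x^k+\frac{d^k}{1+\lambda_k}$$ is globally linearly convergent. (b) If $g=0$, then the damped Newton method $$d^k=-(\nabla^2 f(x^k))^{-1}\nabla f(x^k),\qquad \lambda_k=\sqrt{\langle d^k,\nabla^2 f(x^k)d^k\rangle},\qquad x^{k+1}=x^k+\frac{d^k}{1+\lambda_k}$$ is globally linearly convergent. -/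

import Mathlib

open Set
open scoped NNReal RealInnerProductSpace

noncomputable section

namespace PDN

/-- The Euclidean space of dimension `N`. -/
abbrev E (N : ℕ) : Type := EuclideanSpace ℝ (Fin N)

/-- The effective domain of an extended-real-valued function. -/
def dom {N : ℕ} (h : E N → EReal) : Set (E N) := {x | h x < ⊤}

/-- The real-valued function that agrees with `h` wherever `h` is finite. -/
def toRealFun {N : ℕ} (h : E N → EReal) : E N → ℝ := fun x => (h x).toReal

/-- The gradient of `h` (meaningful at interior points of `dom h` where `h` is differentiable). -/
def grad {N : ℕ} (h : E N → EReal) (x : E N) : E N := gradient (toRealFun h) x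

/-- The Hessian of `h`, as the derivative of the gradient. -/
def hess {N : ℕ} (h : E N → EReal) (x : E N) : E N →L[ℝ] E N := fderiv ℝ (grad h) x

/-- The local norm `‖u‖_x = √⟨u, ∇²f(x) u⟩`. -/
def localNorm {N : ℕ} (f : E N → EReal) (x u : E N) : ℝ := √⟪u, hess f x u⟫

/-- Convexity of an extended-real-valued function: its epigraph is convex. -/
def IsConvexFun {N : ℕ} (h : E N → EReal) : Prop :=
  Convex ℝ {p : E N × ℝ | h p.1 ≤ (p.2 : EReal)}

/-- Proper closed convex functions with values in `ℝ ∪ {∞}`. -/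
structure IsProperClosedConvex {N : ℕ} (g : E N → EReal) : Prop where
  ne_bot : ∀ x, g x ≠ ⊥
  dom_nonempty : (dom g).Nonempty
  convex : IsConvexFun g
  closed : LowerSemicontinuous g

/-- Self-concordant functions with parameter `M`: closed convex functions with values in
`ℝ ∪ {∞}` and open domain, three times continuously differentiable in the domain, such that
`|ψ'''(0)| ≤ M ψ''(0)^{3/2}` for `ψ(t) = f(x + t u)`, for every `x` in the domain and every `u`. -/
structure IsSelfConcordant {N : ℕ} (M : ℝ) (f : E N → EReal) : Prop where
  ne_bot : ∀ x, f x ≠ ⊥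
  convex : IsConvexFun f
  closed : LowerSemicontinuous f
  isOpen_dom : IsOpen (dom f)
  contDiffOn : ContDiffOn ℝ 3 (toRealFun f) (dom f)
  third_le : ∀ x ∈ dom f, ∀ u : E N,
    |iteratedDeriv 3 (fun t : ℝ => toRealFun f (x + t • u)) 0| ≤
      M * (iteratedDeriv 2 (fun t : ℝ => toRealFun f (x + t • u)) 0) ^ (3 / 2 : ℝ)

/-- The standing assumptions on the problem of minimizing `F = f + g`. Continuity of the Hessian
of `f` is part of `contDiffOn` above. -/
structure IsCSCProblem {N : ℕ} (f g : E N → EReal) : Prop where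
  selfConcordant : IsSelfConcordant 2 f
  properClosedConvex : IsProperClosedConvex g
  hess_posDef : ∀ x ∈ dom (f + g), ∀ u : E N, u ≠ 0 → 0 < ⟪u, hess f x u⟫
  existsUnique_min : ∃! x : E N, ∀ y : E N, (f + g) x ≤ (f + g) y

/-- The sublevel set `S(x⁰) = {x : F(x) ≤ F(x⁰)}`. -/
def sublevel {N : ℕ} (F : E N → EReal) (x0 : E N) : Set (E N) := {x | F x ≤ F x0}

/-- `g` is finite near and differentiable at every point of `S`, and its gradient is Lipschitz
continuous on `S`. -/
def IsLipschitzDifferentiableOn {N : ℕ} (g : E N → EReal) (S : Set (E N)) : Prop :=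
  S ⊆ interior (dom g) ∧ (∀ x ∈ S, DifferentiableAt ℝ (toRealFun g) x) ∧
    ∃ L : ℝ≥0, LipschitzOnWith L (grad g) S

/-- The objective of the proximal Newton subproblem at `x`:
`f(x) + ⟨∇f(x), d⟩ + ½⟨d, ∇²f(x) d⟩ + g(x + d)`. -/
def proxNewtonModel {N : ℕ} (f g : E N → EReal) (x d : E N) : EReal :=
  ((toRealFun f x + ⟪grad f x, d⟫ + (1 / 2) * ⟪d, hess f x d⟫ : ℝ) : EReal) + g (x + d)

/-- `d` minimizes the proximal Newton subproblem at `x`. -/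
def IsProxNewtonDirection {N : ℕ} (f g : E N → EReal) (x d : E N) : Prop :=
  ∀ d' : E N, proxNewtonModel f g x d ≤ proxNewtonModel f g x d'

/-- `x` is a sequence generated by the proximal damped Newton method for `f + g`
started at `x0`. -/
def IsPDNSequence {N : ℕ} (f g : E N → EReal) (x0 : E N) (x : ℕ → E N) : Prop :=
  x 0 = x0 ∧ ∀ k, ∃ d : E N, IsProxNewtonDirection f g (x k) d ∧
    x (k + 1) = x k + (1 / (1 + localNorm f (x k) d)) • d

/-- The Newton direction `-(∇²f(x))⁻¹ ∇f(x)`. -/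
def newtonDirection {N : ℕ} (f : E N → EReal) (x : E N) : E N :=
  -((hess f x).inverse (grad f x))

/-- `x` is the sequence generated by the damped Newton method for `f` started at `x0`. -/
def IsDNSequence {N : ℕ} (f : E N → EReal) (x0 : E N) (x : ℕ → E N) : Prop :=
  x 0 = x0 ∧ ∀ k, x (k + 1) =
    x k + (1 / (1 + localNorm f (x k) (newtonDirection f (x k)))) • newtonDirection f (x k)

/-- A method for minimizing `F` from `x0`, given by the set of sequences it can generate, is
globally linearly convergent: `F(xᵏ) - F* ≤ qᵏ (F(x⁰) - F*)` for all `k ≥ 0`, with one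
`q ∈ (0, 1)` for all generated sequences, where `F* = inf F`. -/
def IsGloballyLinearlyConvergent {N : ℕ} (F : E N → EReal) (x0 : E N)
    (Generated : (ℕ → E N) → Prop) : Prop :=
  ∃ q : ℝ, 0 < q ∧ q < 1 ∧ ∀ x : ℕ → E N, Generated x → ∀ k : ℕ,
    F (x k) - (⨅ y, F y) ≤ ((q ^ k : ℝ) : EReal) * (F x0 - (⨅ y, F y))

end PDN

end

open Set
open scoped NNReal RealInnerProductSpace

noncomputable section

namespace PDN

/-! ### One-dimensional estimates -/

lemma log_le_half_sub_inv {x : ℝ} (hx : 1 ≤ x) : Real.log x ≤ (x - x⁻¹) / 2 := by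
  have h := Real.self_le_sinh_iff.2 (Real.log_nonneg hx)
  rwa [Real.sinh_log (by linarith)] at h

lemma sq_div_le_sub_log {l : ℝ} (hl : 0 ≤ l) :
    l ^ 2 / (2 * (1 + l)) ≤ l - Real.log (1 + l) := by
  have h := log_le_half_sub_inv (x := 1 + l) (by linarith)
  have h1 : l ^ 2 / (2 * (1 + l)) = l - (1 + l - (1 + l)⁻¹) / 2 := by
    field_simp
    ring
  linarith

lemma neg_sub_log_one_sub_le {l : ℝ} (hl : 0 ≤ l) (hl' : l ≤ 1 / 2) :
    -l - Real.log (1 - l) ≤ l ^ 2 := by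
  have h0 : 0 < 1 - l := by linarith
  have h := log_le_half_sub_inv (x := (1 - l)⁻¹) ((one_le_inv₀ h0).2 (by linarith))
  rw [Real.log_inv, inv_inv] at h
  have h1 : ((1 - l)⁻¹ - (1 - l)) / 2 ≤ l + l ^ 2 := by
    have : (1 - l)⁻¹ ≤ 2 * (l + l ^ 2) + (1 - l) := by
      rw [inv_le_iff_one_le_mul₀ h0]
      nlinarith [mul_nonneg (sq_nonneg l) (by linarith : 0 ≤ 1 / 2 - l)]
    linarith
  linarith

lemma le_of_hasDerivAt_nonneg {p p' : ℝ → ℝ} {T : ℝ} (hT : 0 ≤ T)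
    (hp : ∀ t ∈ Icc 0 T, HasDerivAt p (p' t) t) (hp' : ∀ t ∈ Icc 0 T, 0 ≤ p' t) :
    p 0 ≤ p T := by
  refine monotoneOn_of_deriv_nonneg (convex_Icc 0 T)
    (fun t ht => (hp t ht).continuousAt.continuousWithinAt)
    (fun t ht => (hp t (interior_subset ht)).differentiableAt.differentiableWithinAt)
    (fun t ht => ?_) (left_mem_Icc.2 hT) (right_mem_Icc.2 hT) hT
  rw [(hp t (interior_subset ht)).deriv]
  exact hp' t (interior_subset ht)

lemma Icc_subset_Icc_of_mem {T t : ℝ} (ht : t ∈ Icc 0 T) : Icc 0 t ⊆ Icc 0 T :=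
  Icc_subset_Icc_right ht.2

/-- Self-concordance bounds the second derivative along a line. -/
lemma second_le_of_third_le {p₂ p₃ : ℝ → ℝ} {T l : ℝ} (hT : 0 ≤ T)
    (h₂ : ∀ t ∈ Icc 0 T, HasDerivAt p₂ (p₃ t) t) (hpos : ∀ t ∈ Icc 0 T, 0 < p₂ t)
    (h₃ : ∀ t ∈ Icc 0 T, p₃ t ≤ 2 * p₂ t ^ (3 / 2 : ℝ)) (hl : l = √(p₂ 0)) (hlT : l * T < 1) :
    p₂ T ≤ l ^ 2 / (1 - l * T) ^ 2 := by
  have hl0 : 0 < l := hl ▸ Real.sqrt_pos.2 (hpos 0 (left_mem_Icc.2 hT))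
  have key : (√(p₂ 0))⁻¹ + 0 ≤ (√(p₂ T))⁻¹ + T := by
    refine le_of_hasDerivAt_nonneg (p := fun t => (√(p₂ t))⁻¹ + t) hT
      (fun t ht => (((h₂ t ht).sqrt (hpos t ht).ne').inv
        (Real.sqrt_pos.2 (hpos t ht)).ne').add (hasDerivAt_id t)) (fun t ht => ?_)
    have hp := hpos t ht
    have hs := Real.sqrt_pos.2 hp
    have h := h₃ t ht
    rw [show (3 / 2 : ℝ) = 1 + 1 / 2 by norm_num, Real.rpow_add hp, Real.rpow_one,
      ← Real.sqrt_eq_rpow] at h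
    have hsq : √(p₂ t) ^ 2 = p₂ t := Real.sq_sqrt hp.le
    rw [hsq, neg_div, div_div, neg_add_eq_sub, sub_nonneg, div_le_one (by positivity)]
    linarith
  rw [← hl, add_zero] at key
  have hsT := Real.sqrt_pos.2 (hpos T (right_mem_Icc.2 hT))
  have hs : √(p₂ T) ≤ l / (1 - l * T) := by
    have h1 : (1 - l * T) / l ≤ (√(p₂ T))⁻¹ := by
      have : (1 - l * T) / l = l⁻¹ - T := by field_simp
      linarith
    have h2 := inv_anti₀ (div_pos (by linarith) hl0) h1
    rwa [inv_inv, inv_div] at h2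
  calc p₂ T = √(p₂ T) ^ 2 := (Real.sq_sqrt (hpos T (right_mem_Icc.2 hT)).le).symm
    _ ≤ (l / (1 - l * T)) ^ 2 := pow_le_pow_left₀ hsT.le hs 2
    _ = _ := div_pow _ _ _

/-- The upper bound on a self-concordant function along a line. -/
lemma le_of_third_le {p p₁ p₂ p₃ : ℝ → ℝ} {T l : ℝ} (hT : 0 ≤ T)
    (h₀ : ∀ t ∈ Icc 0 T, HasDerivAt p (p₁ t) t) (h₁ : ∀ t ∈ Icc 0 T, HasDerivAt p₁ (p₂ t) t)
    (h₂ : ∀ t ∈ Icc 0 T, HasDerivAt p₂ (p₃ t) t) (hpos : ∀ t ∈ Icc 0 T, 0 < p₂ t)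
    (h₃ : ∀ t ∈ Icc 0 T, p₃ t ≤ 2 * p₂ t ^ (3 / 2 : ℝ)) (hl : l = √(p₂ 0)) (hlT : l * T < 1) :
    p T ≤ p 0 + T * p₁ 0 - l * T - Real.log (1 - l * T) := by
  have hl0 : 0 ≤ l := hl ▸ Real.sqrt_nonneg _
  have hlt : ∀ t ∈ Icc 0 T, 0 < 1 - l * t := fun t ht => by
    have := mul_le_mul_of_nonneg_left ht.2 hl0
    linarith
  have hlin : ∀ t, HasDerivAt (fun t => 1 - l * t) (-l) t := fun t => by
    simpa using ((hasDerivAt_id t).const_mul l).const_sub 1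
  have hp₁ : ∀ t ∈ Icc 0 T, p₁ t ≤ p₁ 0 - l + l / (1 - l * t) := fun t ht => by
    have sub := Icc_subset_Icc_of_mem ht
    have := le_of_hasDerivAt_nonneg (p := fun s => l * (1 - l * s)⁻¹ - p₁ s) ht.1
      (fun s hs => (((hlin s).fun_inv (hlt s (sub hs)).ne').const_mul l).sub (h₁ s (sub hs)))
      (fun s hs => by
        have hs' := hs
        have := second_le_of_third_le hs.1
          (fun r hr => h₂ r (sub (Icc_subset_Icc_of_mem hs hr)))
          (fun r hr => hpos r (sub (Icc_subset_Icc_of_mem hs hr)))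
          (fun r hr => h₃ r (sub (Icc_subset_Icc_of_mem hs hr))) hl
          (by linarith [hlt s (sub hs)])
        have e : l * (- -l / (1 - l * s) ^ 2) = l ^ 2 / (1 - l * s) ^ 2 := by ring
        linarith)
    simp only [mul_zero, sub_zero, inv_one, mul_one, ← div_eq_mul_inv] at this
    linarith
  have := le_of_hasDerivAt_nonneg
    (p := fun t => (p₁ 0 - l) * t - Real.log (1 - l * t) - p t) hT
    (fun t ht => ((((hasDerivAt_id t).const_mul (p₁ 0 - l)).sub
      ((hlin t).log (hlt t ht).ne')).sub (h₀ t ht)))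
    (fun t ht => by
      have := hp₁ t ht
      have e : -l / (1 - l * t) = -(l / (1 - l * t)) := neg_div _ _
      rw [e, mul_one]
      linarith)
  simp only [mul_zero, sub_zero, Real.log_one] at this
  linarith

/-- A lower bound on the second derivative bounds a function from below. -/
lemma le_of_le_second {p p₁ p₂ : ℝ → ℝ} {T c : ℝ} (hT : 0 ≤ T)
    (h₀ : ∀ t ∈ Icc 0 T, HasDerivAt p (p₁ t) t) (h₁ : ∀ t ∈ Icc 0 T, HasDerivAt p₁ (p₂ t) t)
    (hc : ∀ t ∈ Icc 0 T, c ≤ p₂ t) : p 0 + T * p₁ 0 + c / 2 * T ^ 2 ≤ p T := by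
  have hp₁ : ∀ t ∈ Icc 0 T, p₁ 0 + c * t ≤ p₁ t := fun t ht => by
    have sub := Icc_subset_Icc_of_mem ht
    have := le_of_hasDerivAt_nonneg (p := fun s => p₁ s - c * s) ht.1
      (fun s hs => (h₁ s (sub hs)).sub ((hasDerivAt_id s).const_mul c))
      (fun s hs => by have := hc s (sub hs); linarith)
    simp only [mul_zero, sub_zero] at this
    linarith
  have := le_of_hasDerivAt_nonneg (p := fun t => p t - p₁ 0 * t - c / 2 * t ^ 2) hT
    (fun t ht => ((h₀ t ht).sub ((hasDerivAt_id t).const_mul (p₁ 0))).sub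
      (((hasDerivAt_id t).fun_pow 2).const_mul (c / 2)))
    (fun t ht => by have := hp₁ t ht; simp only [id]; push_cast; ring_nf; linarith)
  nlinarith

/-! ### Extended-real-valued functions -/

variable {N : ℕ} {f g h : E N → EReal}

lemma coe_toRealFun (hb : ∀ x, h x ≠ ⊥) {x : E N} (hx : x ∈ dom h) :
    ((toRealFun h x : ℝ) : EReal) = h x :=
  EReal.coe_toReal (ne_of_lt hx) (hb x)

lemma mem_dom_and_toRealFun_le (hb : ∀ x, h x ≠ ⊥) {x : E N} {c : ℝ} (hx : h x ≤ c) :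
    x ∈ dom h ∧ toRealFun h x ≤ c := by
  have hd : x ∈ dom h := lt_of_le_of_lt hx (EReal.coe_lt_top c)
  rw [← coe_toRealFun hb hd, EReal.coe_le_coe_iff] at hx
  exact ⟨hd, hx⟩

lemma convexOn_toRealFun (hb : ∀ x, h x ≠ ⊥) (hc : IsConvexFun h) :
    ConvexOn ℝ (dom h) (toRealFun h) := by
  have key : ∀ x ∈ dom h, ∀ y ∈ dom h, ∀ a b : ℝ, 0 ≤ a → 0 ≤ b → a + b = 1 →
      a • x + b • y ∈ dom h ∧
        toRealFun h (a • x + b • y) ≤ a • toRealFun h x + b • toRealFun h y := by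
    intro x hx y hy a b ha hb' hab
    exact mem_dom_and_toRealFun_le hb (hc (x := (x, toRealFun h x)) (y := (y, toRealFun h y))
      (coe_toRealFun hb hx).ge (coe_toRealFun hb hy).ge ha hb' hab)
  exact ⟨fun x hx y hy a b ha hb' hab => (key x hx y hy a b ha hb' hab).1,
    fun x hx y hy a b ha hb' hab => (key x hx y hy a b ha hb' hab).2⟩

lemma mem_dom_add_iff (hf : ∀ x, f x ≠ ⊥) (hg : ∀ x, g x ≠ ⊥) {x : E N} :
    x ∈ dom (f + g) ↔ x ∈ dom f ∧ x ∈ dom g := by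
  simp only [dom, mem_ofPred_eq, Pi.add_apply, lt_top_iff_ne_top]
  rw [EReal.add_ne_top_iff_ne_top₂ (hf x) (hg x)]

lemma add_eq_coe (hf : ∀ x, f x ≠ ⊥) (hg : ∀ x, g x ≠ ⊥) {x : E N} (hxf : x ∈ dom f)
    (hxg : x ∈ dom g) : (f + g) x = ((toRealFun f x + toRealFun g x : ℝ) : EReal) := by
  rw [EReal.coe_add, coe_toRealFun hf hxf, coe_toRealFun hg hxg, Pi.add_apply]

lemma hasDerivAt_line (x d : E N) (t : ℝ) : HasDerivAt (fun s : ℝ => x + s • d) d t := by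
  simpa using ((hasDerivAt_id t).smul_const d).const_add x

lemma hasDerivAt_comp_line {φ : E N → ℝ} {x d : E N} {t : ℝ}
    (hd : DifferentiableAt ℝ φ (x + t • d)) :
    HasDerivAt (fun s : ℝ => φ (x + s • d)) ⟪gradient φ (x + t • d), d⟫ t := by
  have h := hd.hasGradientAt.hasFDerivAt.comp_hasDerivAt t (hasDerivAt_line x d t)
  rwa [InnerProductSpace.toDual_apply_apply] at h

/-- The gradient inequality along a segment. -/
lemma add_inner_le_of_convexOn {s : Set (E N)} {φ : E N → ℝ} (hφ : ConvexOn ℝ s φ) {x y : E N}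
    (hx : x ∈ s) (hy : y ∈ s) (hd : DifferentiableAt ℝ φ x) :
    φ x + ⟪gradient φ x, y - x⟫ ≤ φ y := by
  have hline : HasDerivAt (fun t : ℝ => φ (x + t • (y - x))) ⟪gradient φ x, y - x⟫ 0 := by
    have := hasDerivAt_comp_line (d := y - x) (t := 0) (by simpa using hd)
    rwa [zero_smul, add_zero] at this
  have hsub : ∀ t ∈ Icc (0 : ℝ) 1, x + t • (y - x) ∈ s := fun t ht =>
    hφ.1.add_smul_sub_mem hx hy ht
  have hconv : ConvexOn ℝ (Icc (0 : ℝ) 1) (fun t : ℝ => φ (x + t • (y - x))) := by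
    have := (hφ.comp_affineMap (AffineMap.lineMap x y)).subset
      (fun t ht => by
        simpa [AffineMap.lineMap_apply, add_comm] using hsub t ht) (convex_Icc (0 : ℝ) 1)
    refine this.congr (fun t _ => ?_)
    simp [AffineMap.lineMap_apply, add_comm]
  have := hconv.le_slope_of_hasDerivAt (left_mem_Icc.2 zero_le_one) (right_mem_Icc.2 zero_le_one)
    zero_lt_one hline
  rw [slope_def_field, sub_zero, div_one, one_smul, zero_smul, add_zero,
    add_sub_cancel] at this
  linarith

/-! ### Derivatives of self-concordant functions along lines -/

lemma IsSelfConcordant.contDiffAt {M : ℝ} (hf : IsSelfConcordant M f) {x : E N}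
    (hx : x ∈ dom f) : ContDiffAt ℝ 3 (toRealFun f) x :=
  hf.contDiffOn.contDiffAt (hf.isOpen_dom.mem_nhds hx)

lemma IsSelfConcordant.differentiableAt {M : ℝ} (hf : IsSelfConcordant M f) {x : E N}
    (hx : x ∈ dom f) : DifferentiableAt ℝ (toRealFun f) x :=
  (hf.contDiffAt hx).differentiableAt (by norm_num)

lemma IsSelfConcordant.contDiffAt_grad {M : ℝ} (hf : IsSelfConcordant M f) {x : E N}
    (hx : x ∈ dom f) : ContDiffAt ℝ 2 (grad f) x :=
  (InnerProductSpace.toDual ℝ (E N)).symm.contDiff.contDiffAt.comp x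
    ((hf.contDiffAt hx).fderiv_right (m := 2) (by norm_num))

lemma IsSelfConcordant.hasFDerivAt_grad {M : ℝ} (hf : IsSelfConcordant M f) {x : E N}
    (hx : x ∈ dom f) : HasFDerivAt (grad f) (hess f x) x :=
  ((hf.contDiffAt_grad hx).differentiableAt (by norm_num)).hasFDerivAt

lemma IsSelfConcordant.continuousOn_hess {M : ℝ} (hf : IsSelfConcordant M f) :
    ContinuousOn (hess f) (dom f) := fun _ hx =>
  (((hf.contDiffAt_grad hx).fderiv_right (m := 1) (by norm_num)).continuousAt).continuousWithinAt

lemma IsSelfConcordant.inner_hess_eq {M : ℝ} (hf : IsSelfConcordant M f) {x : E N}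
    (hx : x ∈ dom f) (u v : E N) : ⟪hess f x u, v⟫ = fderiv ℝ (fderiv ℝ (toRealFun f)) x u v := by
  have h1 : HasFDerivAt (fderiv ℝ (toRealFun f))
      (fderiv ℝ (fderiv ℝ (toRealFun f)) x) x :=
    (((hf.contDiffAt hx).fderiv_right (m := 2) (by norm_num)).differentiableAt
      (by norm_num)).hasFDerivAt
  have h2 := ((InnerProductSpace.toDual ℝ (E N)).symm.toContinuousLinearEquiv
    |>.toContinuousLinearMap.hasFDerivAt).comp x h1
  have h3 : hess f x = _ := (hf.hasFDerivAt_grad hx).unique h2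
  rw [h3]
  simp

lemma IsSelfConcordant.hess_symm {M : ℝ} (hf : IsSelfConcordant M f) {x : E N}
    (hx : x ∈ dom f) (u v : E N) : ⟪hess f x u, v⟫ = ⟪u, hess f x v⟫ := by
  rw [hf.inner_hess_eq hx, real_inner_comm, hf.inner_hess_eq hx]
  exact ((hf.contDiffAt hx).isSymmSndFDerivAt (by simp; norm_num)).eq u v

lemma IsSelfConcordant.hasDerivAt_inner_grad {M : ℝ} (hf : IsSelfConcordant M f) {x d : E N}
    {t : ℝ} (hx : x + t • d ∈ dom f) :
    HasDerivAt (fun s : ℝ => ⟪grad f (x + s • d), d⟫) ⟪d, hess f (x + t • d) d⟫ t := by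
  have h := ((hf.hasFDerivAt_grad hx).comp_hasDerivAt t (hasDerivAt_line x d t)).inner ℝ
    (hasDerivAt_const t d)
  simpa [real_inner_comm] using h

lemma IsSelfConcordant.eventually_mem {M : ℝ} (hf : IsSelfConcordant M f) {x d : E N}
    {t : ℝ} (hx : x + t • d ∈ dom f) : ∀ᶠ s : ℝ in nhds t, x + s • d ∈ dom f :=
  (hasDerivAt_line x d t).continuousAt.eventually_mem (hf.isOpen_dom.mem_nhds hx)

lemma IsSelfConcordant.deriv_eventuallyEq {M : ℝ} (hf : IsSelfConcordant M f) {x d : E N}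
    {t : ℝ} (hx : x + t • d ∈ dom f) :
    deriv (fun s : ℝ => toRealFun f (x + s • d)) =ᶠ[nhds t]
      fun s => ⟪grad f (x + s • d), d⟫ := by
  filter_upwards [hf.eventually_mem hx] with s hs
  exact (hasDerivAt_comp_line (hf.differentiableAt hs)).deriv

lemma IsSelfConcordant.iteratedDeriv_two_eq {M : ℝ} (hf : IsSelfConcordant M f) {x d : E N}
    {t : ℝ} (hx : x + t • d ∈ dom f) :
    iteratedDeriv 2 (fun s : ℝ => toRealFun f (x + s • d)) t = ⟪d, hess f (x + t • d) d⟫ := by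
  rw [iteratedDeriv_succ, iteratedDeriv_one, (hf.deriv_eventuallyEq hx).deriv_eq]
  exact (hf.hasDerivAt_inner_grad hx).deriv

lemma IsSelfConcordant.hasDerivAt_inner_hess {M : ℝ} (hf : IsSelfConcordant M f) {x d : E N}
    {t : ℝ} (hx : x + t • d ∈ dom f) :
    HasDerivAt (fun s : ℝ => ⟪d, hess f (x + s • d) d⟫)
      (iteratedDeriv 3 (fun s : ℝ => toRealFun f (x + s • d)) t) t := by
  have h1 : iteratedDeriv 2 (fun s : ℝ => toRealFun f (x + s • d)) =ᶠ[nhds t]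
      fun s => ⟪d, hess f (x + s • d) d⟫ := by
    filter_upwards [hf.eventually_mem hx] with s hs
    exact hf.iteratedDeriv_two_eq hs
  have h2 : DifferentiableAt ℝ (hess f) (x + t • d) :=
    ((hf.contDiffAt_grad hx).fderiv_right (m := 1) (by norm_num)).differentiableAt (by norm_num)
  have h3 : DifferentiableAt ℝ (fun s : ℝ => hess f (x + s • d)) t :=
    h2.comp t (f := fun s : ℝ => x + s • d) (hasDerivAt_line x d t).differentiableAt
  have h4 : DifferentiableAt ℝ (fun s : ℝ => ⟪d, hess f (x + s • d) d⟫) t :=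
    (differentiableAt_const d).inner ℝ (h3.clm_apply (differentiableAt_const d))
  have h5 : iteratedDeriv 3 (fun s : ℝ => toRealFun f (x + s • d)) t =
      deriv (fun s : ℝ => ⟪d, hess f (x + s • d) d⟫) t := by
    rw [iteratedDeriv_succ, h1.deriv_eq]
  rw [h5]
  exact h4.hasDerivAt

lemma IsSelfConcordant.third_le_line {M : ℝ} (hf : IsSelfConcordant M f) {x d : E N}
    {t : ℝ} (hx : x + t • d ∈ dom f) :
    iteratedDeriv 3 (fun s : ℝ => toRealFun f (x + s • d)) t ≤
      M * ⟪d, hess f (x + t • d) d⟫ ^ (3 / 2 : ℝ) := by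
  have h := (le_abs_self _).trans (hf.third_le _ hx d)
  have e : (fun s : ℝ => toRealFun f (x + t • d + s • d)) =
      fun s => (fun s : ℝ => toRealFun f (x + s • d)) (t + s) := by
    funext s
    simp only [add_smul, add_assoc]
  rw [hf.iteratedDeriv_two_eq (by simpa using hx), e,
    iteratedDeriv_comp_const_add 3 (fun s : ℝ => toRealFun f (x + s • d))] at h
  simpa using h

/-! ### The upper bound of self-concordant functions -/

lemma localNorm_sq {x u : E N} (h : 0 ≤ ⟪u, hess f x u⟫) :
    localNorm f x u ^ 2 = ⟪u, hess f x u⟫ := Real.sq_sqrt h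

lemma IsSelfConcordant.le_of_segment (hf : IsSelfConcordant 2 f) {x d : E N} {T : ℝ}
    (hT : 0 ≤ T) (hmem : ∀ t ∈ Icc 0 T, x + t • d ∈ dom f)
    (hpos : ∀ t ∈ Icc 0 T, 0 < ⟪d, hess f (x + t • d) d⟫) (hlT : localNorm f x d * T < 1) :
    toRealFun f (x + T • d) ≤ toRealFun f x + T * ⟪grad f x, d⟫ - localNorm f x d * T -
      Real.log (1 - localNorm f x d * T) := by
  have := le_of_third_le (l := localNorm f x d) hT
    (fun t ht => hasDerivAt_comp_line (hf.differentiableAt (hmem t ht)))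
    (fun t ht => hf.hasDerivAt_inner_grad (hmem t ht))
    (fun t ht => hf.hasDerivAt_inner_hess (hmem t ht)) hpos
    (fun t ht => hf.third_le_line (hmem t ht)) (by simp [localNorm]) hlT
  rwa [zero_smul, add_zero] at this

/-- A self-concordant function is finite at `x + T d` when `‖d‖_x T < 1`, provided that its second
derivative along the line does not vanish, and satisfies the standard upper bound there. -/
lemma IsSelfConcordant.mem_dom_and_le (hf : IsSelfConcordant 2 f) {x d : E N} {T : ℝ}
    (hx : x ∈ dom f) (hT : 0 ≤ T)
    (hpos : ∀ t ∈ Icc 0 T, x + t • d ∈ dom f → 0 < ⟪d, hess f (x + t • d) d⟫)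
    (hlT : localNorm f x d * T < 1) :
    x + T • d ∈ dom f ∧ toRealFun f (x + T • d) ≤ toRealFun f x + T * ⟪grad f x, d⟫ -
      localNorm f x d * T - Real.log (1 - localNorm f x d * T) := by
  have hl0 : 0 ≤ localNorm f x d := Real.sqrt_nonneg _
  have hconv := convexOn_toRealFun hf.ne_bot hf.convex
  have hseg : ∀ t : ℝ, 0 ≤ t → x + t • d ∈ dom f → ∀ s ∈ Icc 0 t, x + s • d ∈ dom f := by
    intro t ht htd s hs
    rcases ht.eq_or_lt with rfl | ht
    · rwa [le_antisymm hs.2 hs.1]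
    · have := hconv.1.add_smul_mem hx htd (t := s / t)
        ⟨div_nonneg hs.1 ht.le, div_le_one_of_le₀ hs.2 ht.le⟩
      rwa [smul_smul, div_mul_cancel₀ _ ht.ne'] at this
  have hbound : ∀ t ∈ Icc 0 T, x + t • d ∈ dom f →
      toRealFun f (x + t • d) ≤ toRealFun f x + t * ⟪grad f x, d⟫ -
        localNorm f x d * t - Real.log (1 - localNorm f x d * t) := fun t ht htd =>
    hf.le_of_segment ht.1 (hseg t ht.1 htd)
      (fun s hs => hpos s (Icc_subset_Icc_of_mem ht hs) (hseg t ht.1 htd s hs))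
      (lt_of_le_of_lt (mul_le_mul_of_nonneg_left ht.2 hl0) hlT)
  suffices hmem : x + T • d ∈ dom f from ⟨hmem, hbound T (right_mem_Icc.2 hT) hmem⟩
  obtain ⟨K, hK⟩ : ∃ K : ℝ, ∀ t ∈ Icc 0 T, toRealFun f x + t * ⟪grad f x, d⟫ -
        localNorm f x d * t - Real.log (1 - localNorm f x d * t) ≤ K := by
    have hc : ContinuousOn (fun t => toRealFun f x + t * ⟪grad f x, d⟫ -
        localNorm f x d * t - Real.log (1 - localNorm f x d * t)) (Icc 0 T) := by
      refine ContinuousOn.sub (by fun_prop) (ContinuousOn.log (by fun_prop) fun t ht => ?_)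
      have := mul_le_mul_of_nonneg_left ht.2 hl0
      linarith
    obtain ⟨K, hK⟩ := (isCompact_Icc.image_of_continuousOn hc).bddAbove
    exact ⟨K, fun t ht => hK (mem_image_of_mem _ ht)⟩
  have hcl : IsClosed {t : ℝ | f (x + t • d) ≤ K} :=
    (hf.closed.isClosed_preimage (K : EReal)).preimage
      (by fun_prop : Continuous fun t : ℝ => x + t • d)
  have hle : ∀ t ∈ Icc 0 T, x + t • d ∈ dom f → f (x + t • d) ≤ K := fun t ht htd => by
    rw [← coe_toRealFun hf.ne_bot htd, EReal.coe_le_coe_iff]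
    exact (hbound t ht htd).trans (hK t ht)
  have hsub : Icc 0 T ⊆ {t : ℝ | f (x + t • d) ≤ K} ∪ Ioi T := by
    refine IsClosed.Icc_subset_of_forall_mem_nhdsWithin ?_ ?_ ?_
    · have : ({t : ℝ | f (x + t • d) ≤ K} ∪ Ioi T) ∩ Icc 0 T =
          {t : ℝ | f (x + t • d) ≤ K} ∩ Icc 0 T := by
        ext t
        constructor
        · rintro ⟨h | h, ht⟩
          · exact ⟨h, ht⟩
          · exact absurd ht.2 (not_le.2 h)
        · exact fun h => ⟨Or.inl h.1, h.2⟩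
      rw [this]
      exact hcl.inter isClosed_Icc
    · exact Or.inl (hle 0 (left_mem_Icc.2 hT) (by simpa using hx))
    · rintro t ⟨h | h, ht⟩
      · have htd : x + t • d ∈ dom f := lt_of_le_of_lt h (EReal.coe_lt_top K)
        filter_upwards [mem_nhdsWithin_of_mem_nhds (hf.eventually_mem htd),
          self_mem_nhdsWithin] with s hs hts
        rcases le_or_gt s T with h' | h'
        · exact Or.inl (hle s ⟨ht.1.trans (le_of_lt hts), h'⟩ hs)
        · exact Or.inr h'
      · exact absurd ht.2 (not_lt.2 (le_of_lt h))
  rcases hsub (right_mem_Icc.2 hT) with h | h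
  · exact lt_of_le_of_lt h (EReal.coe_lt_top K)
  · exact absurd h (lt_irrefl T)

variable {x d : E N}

/-! ### The proximal Newton direction -/

lemma proxNewtonModel_eq_coe (hg : ∀ x, g x ≠ ⊥) (hd : x + d ∈ dom g) :
    proxNewtonModel f g x d = ((toRealFun f x + ⟪grad f x, d⟫ + (1 / 2) * ⟪d, hess f x d⟫ +
      toRealFun g (x + d) : ℝ) : EReal) := by
  rw [EReal.coe_add _ (toRealFun g (x + d)), coe_toRealFun hg hd, proxNewtonModel]

lemma IsProxNewtonDirection.add_mem_dom (hd : IsProxNewtonDirection f g x d)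
    (hg : ∀ x, g x ≠ ⊥) (hx : x ∈ dom g) : x + d ∈ dom g := by
  have h := hd 0
  rw [proxNewtonModel_eq_coe (d := 0) hg (by simpa using hx)] at h
  by_contra hne
  rw [dom, mem_ofPred_eq, not_lt, top_le_iff] at hne
  rw [proxNewtonModel, hne, EReal.coe_add_top] at h
  exact absurd h (not_le.2 (EReal.coe_lt_top _))

lemma IsProxNewtonDirection.model_le (hd : IsProxNewtonDirection f g x d)
    (hg : ∀ x, g x ≠ ⊥) (hx : x ∈ dom g) {d' : E N} (hd' : x + d' ∈ dom g) :
    ⟪grad f x, d⟫ + (1 / 2) * ⟪d, hess f x d⟫ + toRealFun g (x + d) ≤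
      ⟪grad f x, d'⟫ + (1 / 2) * ⟪d', hess f x d'⟫ + toRealFun g (x + d') := by
  have h := hd d'
  rw [proxNewtonModel_eq_coe hg hd', proxNewtonModel_eq_coe hg (hd.add_mem_dom hg hx),
    EReal.coe_le_coe_iff] at h
  linarith

lemma _root_.ConvexOn.le_of_segment {s : Set (E N)} {φ : E N → ℝ} (hφ : ConvexOn ℝ s φ)
    (hx : x ∈ s) (hd : x + d ∈ s) {t : ℝ} (h0 : 0 ≤ t) (h1 : t ≤ 1) :
    x + t • d ∈ s ∧ φ (x + t • d) ≤ (1 - t) * φ x + t * φ (x + d) := by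
  have e : x + t • d = (1 - t) • x + t • (x + d) := by module
  rw [e]
  exact ⟨hφ.1 hx hd (by linarith) h0 (by ring), hφ.2 hx hd (by linarith) h0 (by ring)⟩

lemma IsProxNewtonDirection.sub_le (hd : IsProxNewtonDirection f g x d)
    (hg : IsProperClosedConvex g) (hx : x ∈ dom g) :
    toRealFun g (x + d) - toRealFun g x ≤ -⟪grad f x, d⟫ - ⟪d, hess f x d⟫ := by
  have hconv := convexOn_toRealFun hg.ne_bot hg.convex
  have hxd := hd.add_mem_dom hg.ne_bot hx
  have key : ∀ s : ℝ, 0 ≤ s → s < 1 → toRealFun g (x + d) - toRealFun g x +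
      ⟪grad f x, d⟫ + ⟪d, hess f x d⟫ ≤ (1 - s) * (⟪d, hess f x d⟫ / 2) := by
    intro s hs hs1
    obtain ⟨h1, h2⟩ := hconv.le_of_segment hx hxd hs hs1.le
    have h3 := hd.model_le hg.ne_bot hx h1
    rw [map_smul, inner_smul_left, inner_smul_right, inner_smul_right] at h3
    simp only [conj_trivial] at h3
    have h4 : (1 - s) * (toRealFun g (x + d) - toRealFun g x +
      ⟪grad f x, d⟫ + ⟪d, hess f x d⟫) ≤ (1 - s) * ((1 - s) * (⟪d, hess f x d⟫ / 2)) := by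
      linarith
    exact le_of_mul_le_mul_left h4 (by linarith)
  have : toRealFun g (x + d) - toRealFun g x + ⟪grad f x, d⟫ + ⟪d, hess f x d⟫ ≤ 0 := by
    have hlim : Filter.Tendsto (fun s : ℝ => (1 - s) * (⟪d, hess f x d⟫ / 2))
        (nhdsWithin 1 (Iio 1)) (nhds ((1 - 1) * (⟪d, hess f x d⟫ / 2))) :=
      (Continuous.tendsto (by fun_prop) 1).mono_left nhdsWithin_le_nhds
    rw [sub_self, zero_mul] at hlim
    refine ge_of_tendsto hlim ?_
    filter_upwards [Ioo_mem_nhdsLT (zero_lt_one' ℝ)] with s hs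
    exact key s hs.1.le hs.2
  linarith

/-- The first-order optimality condition of the proximal Newton subproblem. -/
lemma IsProxNewtonDirection.grad_add_eq_zero (hd : IsProxNewtonDirection f g x d)
    (hf : IsSelfConcordant 2 f) (hg : IsProperClosedConvex g) (hxf : x ∈ dom f) (hx : x ∈ dom g)
    (hint : x + d ∈ interior (dom g)) (hdiff : DifferentiableAt ℝ (toRealFun g) (x + d)) :
    grad f x + hess f x d + grad g (x + d) = 0 := by
  refine ext_inner_right ℝ fun u => ?_
  have hmin : IsLocalMin (fun t : ℝ => ⟪grad f x, d + t • u⟫ +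
      (1 / 2) * ⟪d + t • u, hess f x (d + t • u)⟫ + toRealFun g (x + d + t • u)) 0 := by
    have hev : ∀ᶠ t : ℝ in nhds 0, x + d + t • u ∈ interior (dom g) :=
      (hasDerivAt_line (x + d) u 0).continuousAt.eventually_mem
        (isOpen_interior.mem_nhds (by simpa using hint))
    filter_upwards [hev] with t ht
    simpa [add_assoc] using hd.model_le hg.ne_bot hx (d' := d + t • u)
      (by simpa [add_assoc] using interior_subset ht)
  have hl := hasDerivAt_line d u 0
  have hder := (((hasDerivAt_const (0 : ℝ) (grad f x)).inner ℝ hl).add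
    ((hl.inner ℝ ((hess f x).hasFDerivAt.comp_hasDerivAt (0 : ℝ) hl)).const_mul (1 / 2))).add
    (hasDerivAt_comp_line (φ := toRealFun g) (x := x + d) (d := u) (t := 0) (by simpa using hdiff))
  have h0 := hmin.hasDerivAt_eq_zero hder
  have hs := hf.hess_symm hxf d u
  have hc := real_inner_comm (hess f x d) u
  simp only [zero_smul, add_zero, inner_zero_left, Function.comp_apply] at h0
  rw [inner_add_left, inner_add_left, inner_zero_left]
  rw [show grad g (x + d) = gradient (toRealFun g) (x + d) from rfl]
  linarith

/-- Conversely, the Newton direction minimizes the quadratic model. -/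
lemma isProxNewtonDirection_newtonDirection (hf : IsSelfConcordant 2 f) (hx : x ∈ dom f)
    (hpos : ∀ u : E N, u ≠ 0 → 0 < ⟪u, hess f x u⟫) :
    IsProxNewtonDirection f 0 x (newtonDirection f x) := by
  have hinj : Function.Injective (hess f x) := by
    refine (injective_iff_map_eq_zero _).2 fun u hu => ?_
    by_contra hne
    have := hpos u hne
    rw [hu, inner_zero_right] at this
    exact lt_irrefl _ this
  have hinv : (hess f x).IsInvertible :=
    ⟨(LinearEquiv.ofInjectiveEndo (hess f x : E N →ₗ[ℝ] E N) hinj).toContinuousLinearEquiv, by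
      ext u
      simp⟩
  have hH : hess f x (newtonDirection f x) = -grad f x := by
    obtain ⟨e, he⟩ := hinv
    rw [newtonDirection, map_neg, ← he, ContinuousLinearMap.inverse_equiv]
    simp
  intro d'
  set d := newtonDirection f x
  simp only [proxNewtonModel, Pi.zero_apply, add_zero, EReal.coe_le_coe_iff]
  have h1 : 0 ≤ ⟪d' - d, hess f x (d' - d)⟫ := by
    by_cases h : d' - d = 0
    · simp [h]
    · exact (hpos _ h).le
  have h2 := hf.hess_symm hx d d'
  have h3 := real_inner_comm (hess f x d) d'
  have h4 : ⟪hess f x d, d'⟫ = -⟪grad f x, d'⟫ := by rw [hH, inner_neg_left]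
  have h5 : ⟪d, hess f x d⟫ = -⟪grad f x, d⟫ := by rw [hH, inner_neg_right, real_inner_comm]
  rw [map_sub, inner_sub_left, inner_sub_right, inner_sub_right] at h1
  linarith

/-! ### Decrease along the proximal Newton direction -/

lemma IsCSCProblem.mem_dom_iff (hp : IsCSCProblem f g) :
    x ∈ dom (f + g) ↔ x ∈ dom f ∧ x ∈ dom g :=
  mem_dom_add_iff hp.selfConcordant.ne_bot hp.properClosedConvex.ne_bot

lemma IsCSCProblem.add_eq_coe (hp : IsCSCProblem f g) (hx : x ∈ dom (f + g)) :
    (f + g) x = ((toRealFun f x + toRealFun g x : ℝ) : EReal) :=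
  PDN.add_eq_coe hp.selfConcordant.ne_bot hp.properClosedConvex.ne_bot
    (hp.mem_dom_iff.1 hx).1 (hp.mem_dom_iff.1 hx).2

lemma IsCSCProblem.inner_hess_nonneg (hp : IsCSCProblem f g) (hx : x ∈ dom (f + g)) (u : E N) :
    0 ≤ ⟪u, hess f x u⟫ := by
  rcases eq_or_ne u 0 with rfl | h
  · simp
  · exact (hp.hess_posDef x hx u h).le

lemma IsCSCProblem.decrease (hp : IsCSCProblem f g) (hx : x ∈ dom (f + g))
    (hd : IsProxNewtonDirection f g x d) {T : ℝ} (hT : 0 ≤ T) (hT1 : T ≤ 1)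
    (hlT : localNorm f x d * T < 1) :
    x + T • d ∈ dom (f + g) ∧
      toRealFun f (x + T • d) + toRealFun g (x + T • d) ≤ toRealFun f x + toRealFun g x -
        T * localNorm f x d ^ 2 - localNorm f x d * T - Real.log (1 - localNorm f x d * T) := by
  obtain ⟨hxf, hxg⟩ := hp.mem_dom_iff.1 hx
  rcases eq_or_ne d 0 with rfl | hd0
  · simpa [localNorm] using hx
  have hconv := convexOn_toRealFun hp.properClosedConvex.ne_bot hp.properClosedConvex.convex
  have hxd := hd.add_mem_dom hp.properClosedConvex.ne_bot hxg
  obtain ⟨h1, h2⟩ := hp.selfConcordant.mem_dom_and_le hxf hT (fun t ht htd =>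
    hp.hess_posDef _ (hp.mem_dom_iff.2
      ⟨htd, (hconv.le_of_segment hxg hxd ht.1 (ht.2.trans hT1)).1⟩) d hd0) hlT
  obtain ⟨h3, h4⟩ := hconv.le_of_segment hxg hxd hT hT1
  refine ⟨hp.mem_dom_iff.2 ⟨h1, h3⟩, ?_⟩
  have h5 := mul_le_mul_of_nonneg_left (hd.sub_le hp.properClosedConvex hxg) hT
  rw [localNorm_sq (hp.inner_hess_nonneg hx d)]
  linarith

lemma IsCSCProblem.decrease_damped (hp : IsCSCProblem f g) (hx : x ∈ dom (f + g))
    (hd : IsProxNewtonDirection f g x d) {y : E N}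
    (hy : y = x + (1 / (1 + localNorm f x d)) • d) :
    y ∈ dom (f + g) ∧ toRealFun f y + toRealFun g y ≤ toRealFun f x + toRealFun g x -
        localNorm f x d ^ 2 / (2 * (1 + localNorm f x d)) := by
  have hl : 0 ≤ localNorm f x d := Real.sqrt_nonneg _
  set l := localNorm f x d with hl_def
  have h1 : 1 - l * (1 / (1 + l)) = (1 + l)⁻¹ := by field_simp; ring
  have hpos : 0 < (1 + l)⁻¹ := by positivity
  obtain ⟨h2, h3⟩ := hp.decrease hx hd (T := 1 / (1 + l)) (by positivity)
    (by rw [div_le_one (by positivity)]; linarith) (by rw [← hl_def]; linarith)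
  rw [← hl_def, h1, Real.log_inv, ← hy] at h3
  rw [← hy] at h2
  refine ⟨h2, h3.trans ?_⟩
  have h4 := sq_div_le_sub_log hl
  have h5 : 1 / (1 + l) * l ^ 2 + l * (1 / (1 + l)) = l := by field_simp; ring
  linarith

variable {x₀ xs : E N}

/-! ### Compactness of the sublevel sets -/

lemma IsCSCProblem.convexOn (hp : IsCSCProblem f g) :
    ConvexOn ℝ (dom (f + g)) (fun x => toRealFun f x + toRealFun g x) := by
  have hf := convexOn_toRealFun hp.selfConcordant.ne_bot hp.selfConcordant.convex
  have hg := convexOn_toRealFun hp.properClosedConvex.ne_bot hp.properClosedConvex.convex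
  have e : dom (f + g) = dom f ∩ dom g := ext fun x => hp.mem_dom_iff
  rw [e]
  exact (hf.subset inter_subset_left (hf.1.inter hg.1)).add
    (hg.subset inter_subset_right (hf.1.inter hg.1))

lemma IsCSCProblem.lowerSemicontinuous (hp : IsCSCProblem f g) :
    LowerSemicontinuous (f + g) :=
  LowerSemicontinuous.add' hp.selfConcordant.closed hp.properClosedConvex.closed fun x =>
    EReal.continuousAt_add (Or.inr (hp.properClosedConvex.ne_bot x))
      (Or.inl (hp.selfConcordant.ne_bot x))

lemma sublevel_subset (hx₀ : x₀ ∈ dom (f + g)) :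
    sublevel (f + g) x₀ ⊆ dom (f + g) :=
    fun x hx => (show (f + g) x < ⊤ from lt_of_le_of_lt hx hx₀)

lemma IsCSCProblem.mem_sublevel_iff (hp : IsCSCProblem f g) (hx₀ : x₀ ∈ dom (f + g))
    (hx : x ∈ dom (f + g)) : x ∈ sublevel (f + g) x₀ ↔
      toRealFun f x + toRealFun g x ≤ toRealFun f x₀ + toRealFun g x₀ := by
  rw [sublevel, mem_ofPred_eq, hp.add_eq_coe hx, hp.add_eq_coe hx₀, EReal.coe_le_coe_iff]

lemma IsCSCProblem.convex_sublevel (hp : IsCSCProblem f g) (hx₀ : x₀ ∈ dom (f + g)) :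
    Convex ℝ (sublevel (f + g) x₀) := by
  convert hp.convexOn.convex_le (toRealFun f x₀ + toRealFun g x₀) using 1
  ext x
  constructor
  · exact fun hx => ⟨sublevel_subset hx₀ hx,
      (hp.mem_sublevel_iff hx₀ (sublevel_subset hx₀ hx)).1 hx⟩
  · exact fun hx => (hp.mem_sublevel_iff hx₀ hx.1).2 hx.2

lemma IsCSCProblem.exists_norm_sub_le (hp : IsCSCProblem f g) (hx₀ : x₀ ∈ dom (f + g))
    (hmin : ∀ y, (f + g) xs ≤ (f + g) y) :
    ∃ R : ℝ, ∀ x ∈ sublevel (f + g) x₀, ‖x - xs‖ ≤ R := by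
  have hxs : xs ∈ dom (f + g) := lt_of_le_of_lt (hmin x₀) hx₀
  set Fs := toRealFun f xs + toRealFun g xs with hFs
  set F₀ := toRealFun f x₀ + toRealFun g x₀ with hF₀
  by_cases hne : (Metric.sphere xs 1).Nonempty
  swap
  · refine ⟨1, fun x _ => ?_⟩
    by_contra! hlt
    have hpos : 0 < ‖x - xs‖ := by linarith
    exact hne ⟨xs + ‖x - xs‖⁻¹ • (x - xs), by
      simp [norm_smul, hpos.ne']⟩
  obtain ⟨z, hz, hzmin⟩ := (hp.lowerSemicontinuous.lowerSemicontinuousOn _).exists_isMinOn hne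
    (isCompact_sphere xs 1)
  have hlt : (f + g) xs < (f + g) z := by
    refine lt_of_not_ge fun hle => ?_
    have : z = xs := hp.existsUnique_min.unique (fun y => hle.trans (hmin y)) hmin
    simp [this] at hz
  obtain ⟨c, hc1, hc2⟩ := EReal.lt_iff_exists_real_btwn.1 hlt
  rw [hp.add_eq_coe hxs, EReal.coe_lt_coe_iff, ← hFs] at hc1
  refine ⟨max 1 ((F₀ - Fs) / (c - Fs)), fun x hx => ?_⟩
  rcases le_or_gt ‖x - xs‖ 1 with h | h
  · exact h.trans (le_max_left _ _)
  refine le_max_of_le_right ?_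
  have hpos : 0 < ‖x - xs‖ := by linarith
  have hxd := sublevel_subset hx₀ hx
  have hxF := (hp.mem_sublevel_iff hx₀ hxd).1 hx
  obtain ⟨h1, h2⟩ := hp.convexOn.le_of_segment (d := x - xs) hxs (by simpa using hxd)
    (inv_nonneg.2 hpos.le) (inv_le_one_of_one_le₀ h.le)
  have hy : xs + ‖x - xs‖⁻¹ • (x - xs) ∈ Metric.sphere xs 1 := by
    simp [norm_smul, hpos.ne']
  have h3 := hc2.le.trans (hzmin hy)
  rw [hp.add_eq_coe h1, EReal.coe_le_coe_iff] at h3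
  rw [add_sub_cancel] at h2
  have h4 : c - Fs ≤ ‖x - xs‖⁻¹ * (F₀ - Fs) := by
    have := mul_le_mul_of_nonneg_left hxF (inv_nonneg.2 hpos.le)
    linarith
  rw [inv_mul_eq_div, le_div_iff₀ hpos] at h4
  rw [le_div_iff₀ (by linarith)]
  linarith

lemma IsCSCProblem.isCompact_sublevel (hp : IsCSCProblem f g) (hx₀ : x₀ ∈ dom (f + g)) :
    IsCompact (sublevel (f + g) x₀) := by
  obtain ⟨xs, hmin, -⟩ := hp.existsUnique_min
  obtain ⟨R, hR⟩ := hp.exists_norm_sub_le hx₀ hmin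
  exact (isCompact_closedBall xs R).of_isClosed_subset
    (hp.lowerSemicontinuous.isClosed_preimage ((f + g) x₀))
    fun x hx => mem_closedBall_iff_norm.2 (hR x hx)

lemma IsCSCProblem.exists_hess_ge (hp : IsCSCProblem f g) {S : Set (E N)} (hS : IsCompact S)
    (hsub : S ⊆ dom (f + g)) :
    ∃ m : ℝ, 0 < m ∧ ∀ x ∈ S, ∀ u : E N, m * ‖u‖ ^ 2 ≤ ⟪u, hess f x u⟫ := by
  by_cases hne : (S ×ˢ Metric.sphere (0 : E N) 1).Nonempty
  swap
  · refine ⟨1, one_pos, fun x hx u => ?_⟩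
    rcases eq_or_ne u 0 with rfl | hu
    · simp
    · exact absurd ⟨(x, ‖u‖⁻¹ • u), hx, by simp [norm_smul, hu]⟩ hne
  have hc : ContinuousOn (fun p : E N × E N => ⟪p.2, hess f p.1 p.2⟫)
      (S ×ˢ Metric.sphere (0 : E N) 1) := by
    refine continuousOn_snd.inner ((ContinuousOn.clm_apply ?_ continuousOn_snd))
    exact hp.selfConcordant.continuousOn_hess.comp continuousOn_fst
      fun p hpS => (hp.mem_dom_iff.1 (hsub hpS.1)).1
  obtain ⟨⟨z, v⟩, ⟨hz, hv⟩, hmin⟩ := (hS.prod (isCompact_sphere _ _)).exists_isMinOn hne hc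
  have hv0 : v ≠ 0 := by
    rintro rfl
    simp at hv
  refine ⟨_, hp.hess_posDef z (hsub hz) v hv0, fun x hx u => ?_⟩
  rcases eq_or_ne u 0 with rfl | hu
  · simp
  have hu' : 0 < ‖u‖ := norm_pos_iff.2 hu
  have h1 : ⟪v, hess f z v⟫ ≤ ⟪‖u‖⁻¹ • u, hess f x (‖u‖⁻¹ • u)⟫ :=
    hmin (a := (x, ‖u‖⁻¹ • u)) ⟨hx, by simp [norm_smul, hu]⟩
  rw [map_smul, inner_smul_left, inner_smul_right, conj_trivial] at h1
  calc ⟪v, hess f z v⟫ * ‖u‖ ^ 2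
      ≤ ‖u‖⁻¹ * (‖u‖⁻¹ * ⟪u, hess f x u⟫) * ‖u‖ ^ 2 :=
        mul_le_mul_of_nonneg_right h1 (sq_nonneg _)
    _ = ⟪u, hess f x u⟫ := by field_simp

lemma IsCSCProblem.exists_norm_hess_le (hp : IsCSCProblem f g) {S : Set (E N)}
    (hS : IsCompact S) (hsub : S ⊆ dom (f + g)) : ∃ B : ℝ, ∀ x ∈ S, ‖hess f x‖ ≤ B :=
  hS.exists_bound_of_continuousOn (hp.selfConcordant.continuousOn_hess.mono
    fun _ hx => (hp.mem_dom_iff.1 (hsub hx)).1)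

/-! ### Linear convergence -/

/-- Strong convexity on the sublevel set bounds the optimality gap by the squared gradient. -/
lemma IsCSCProblem.gap_le (hp : IsCSCProblem f g) (hx₀ : x₀ ∈ dom (f + g))
    {m : ℝ} (hm : 0 < m)
    (hess_ge : ∀ x ∈ sublevel (f + g) x₀, ∀ u : E N, m * ‖u‖ ^ 2 ≤ ⟪u, hess f x u⟫)
    (hx : x ∈ sublevel (f + g) x₀) (hxs : xs ∈ sublevel (f + g) x₀)
    (hdiff : DifferentiableAt ℝ (toRealFun g) x) :
    toRealFun f x + toRealFun g x - (toRealFun f xs + toRealFun g xs) ≤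
      ‖grad f x + grad g x‖ ^ 2 / (2 * m) := by
  have hseg : ∀ t ∈ Icc (0 : ℝ) 1, x + t • (xs - x) ∈ sublevel (f + g) x₀ := fun t ht =>
    (hp.convex_sublevel hx₀).add_smul_sub_mem hx hxs ht
  have hsegf : ∀ t ∈ Icc (0 : ℝ) 1, x + t • (xs - x) ∈ dom f := fun t ht =>
    (hp.mem_dom_iff.1 (sublevel_subset hx₀ (hseg t ht))).1
  have h1 := le_of_le_second (p := fun t : ℝ => toRealFun f (x + t • (xs - x))) zero_le_one
    (fun t ht => hasDerivAt_comp_line (hp.selfConcordant.differentiableAt (hsegf t ht)))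
    (fun t ht => hp.selfConcordant.hasDerivAt_inner_grad (hsegf t ht))
    (fun t ht => hess_ge _ (hseg t ht) (xs - x))
  have h2 := add_inner_le_of_convexOn
    (convexOn_toRealFun hp.properClosedConvex.ne_bot hp.properClosedConvex.convex)
    (hp.mem_dom_iff.1 (sublevel_subset hx₀ hx)).2
    (hp.mem_dom_iff.1 (sublevel_subset hx₀ hxs)).2 hdiff
  simp only [zero_smul, add_zero, one_smul, add_sub_cancel, one_mul, one_pow, mul_one] at h1
  change toRealFun f x + ⟪grad f x, xs - x⟫ + _ ≤ _ at h1
  change toRealFun g x + ⟪grad g x, xs - x⟫ ≤ _ at h2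
  have h3 := neg_le_of_abs_le (abs_real_inner_le_norm (grad f x + grad g x) (xs - x))
  rw [inner_add_left] at h3
  rw [le_div_iff₀ (by positivity)]
  nlinarith [sq_nonneg (‖grad f x + grad g x‖ - m * ‖xs - x‖)]

/-- For a short proximal Newton direction, the gradient is bounded by its local norm. -/
lemma IsCSCProblem.norm_grad_le (hp : IsCSCProblem f g) (hx₀ : x₀ ∈ dom (f + g))
    {m B : ℝ} (hm : 0 < m) {L : ℝ≥0}
    (hess_ge : ∀ x ∈ sublevel (f + g) x₀, ∀ u : E N, m * ‖u‖ ^ 2 ≤ ⟪u, hess f x u⟫)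
    (hess_le : ∀ x ∈ sublevel (f + g) x₀, ‖hess f x‖ ≤ B)
    (hint : sublevel (f + g) x₀ ⊆ interior (dom g))
    (hdiff : ∀ x ∈ sublevel (f + g) x₀, DifferentiableAt ℝ (toRealFun g) x)
    (hL : LipschitzOnWith L (grad g) (sublevel (f + g) x₀))
    (hx : x ∈ sublevel (f + g) x₀) (hd : IsProxNewtonDirection f g x d)
    (hl : localNorm f x d ≤ 1 / 2) :
    ‖grad f x + grad g x‖ ^ 2 ≤ (L + B) ^ 2 / m * localNorm f x d ^ 2 := by
  have hxd := sublevel_subset hx₀ hx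
  have hl0 : 0 ≤ localNorm f x d := Real.sqrt_nonneg _
  have hxS : x + d ∈ sublevel (f + g) x₀ := by
    obtain ⟨h1, h2⟩ := hp.decrease hxd hd zero_le_one le_rfl (by linarith)
    have h3 := neg_sub_log_one_sub_le hl0 hl
    simp only [one_smul, mul_one, one_mul] at h1 h2
    refine (hp.mem_sublevel_iff hx₀ h1).2 ?_
    have := (hp.mem_sublevel_iff hx₀ hxd).1 hx
    linarith
  have hopt := hd.grad_add_eq_zero hp.selfConcordant hp.properClosedConvex
    (hp.mem_dom_iff.1 hxd).1 (hp.mem_dom_iff.1 hxd).2 (hint hxS) (hdiff _ hxS)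
  have e : grad f x + grad g x = (grad g x - grad g (x + d)) - hess f x d := by
    rw [eq_sub_iff_add_eq, eq_sub_iff_add_eq, ← sub_eq_zero, ← hopt]
    abel
  have h1 : ‖grad g x - grad g (x + d)‖ ≤ L * ‖d‖ := by
    have := hL.norm_sub_le hx hxS
    rwa [sub_add_cancel_left, norm_neg] at this
  have h2 : ‖hess f x d‖ ≤ B * ‖d‖ := (hess f x).le_of_opNorm_le (hess_le x hx) d
  have h3 : ‖grad f x + grad g x‖ ≤ (L + B) * ‖d‖ := by
    rw [e]
    exact (norm_sub_le _ _).trans (by linarith)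
  have h4 := hess_ge x hx d
  rw [← localNorm_sq (hp.inner_hess_nonneg hxd d)] at h4
  calc ‖grad f x + grad g x‖ ^ 2 ≤ ((L + B) * ‖d‖) ^ 2 :=
        pow_le_pow_left₀ (norm_nonneg _) h3 2
    _ = (L + B) ^ 2 / m * (m * ‖d‖ ^ 2) := by field_simp
    _ ≤ _ := mul_le_mul_of_nonneg_left h4 (by positivity)

/-- One step of the proximal damped Newton method contracts the optimality gap. -/
lemma IsCSCProblem.exists_contraction (hp : IsCSCProblem f g) (hx₀ : x₀ ∈ dom (f + g))
    (hg : IsLipschitzDifferentiableOn g (sublevel (f + g) x₀))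
    (hmin : ∀ y, (f + g) xs ≤ (f + g) y) :
    ∃ q : ℝ, 0 < q ∧ q < 1 ∧ ∀ x ∈ sublevel (f + g) x₀, ∀ d y : E N,
      IsProxNewtonDirection f g x d → y = x + (1 / (1 + localNorm f x d)) • d →
      y ∈ sublevel (f + g) x₀ ∧
        toRealFun f y + toRealFun g y - (toRealFun f xs + toRealFun g xs) ≤
          q * (toRealFun f x + toRealFun g x - (toRealFun f xs + toRealFun g xs)) := by
  obtain ⟨hint, hdiff, L, hL⟩ := hg
  have hS := hp.isCompact_sublevel hx₀
  obtain ⟨m, hm, hess_ge⟩ := hp.exists_hess_ge hS (sublevel_subset hx₀)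
  obtain ⟨B, hess_le⟩ := hp.exists_norm_hess_le hS (sublevel_subset hx₀)
  have hxsS : xs ∈ sublevel (f + g) x₀ := hmin x₀
  have hgap : ∀ y ∈ dom (f + g), toRealFun f xs + toRealFun g xs ≤
      toRealFun f y + toRealFun g y := fun y hy => by
    have := hmin y
    rwa [hp.add_eq_coe hy, hp.add_eq_coe (sublevel_subset hx₀ hxsS),
      EReal.coe_le_coe_iff] at this
  set Fs := toRealFun f xs + toRealFun g xs
  set F₀ := toRealFun f x₀ + toRealFun g x₀
  have hF₀ : Fs ≤ F₀ := hgap x₀ hx₀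
  set C := (L + B) ^ 2 / m / (2 * m) with hC
  have hC0 : 0 ≤ C := by positivity
  set ε := min (1 / (3 * (C + 1))) (1 / (12 * (F₀ - Fs + 1))) with hε
  have hε0 : 0 < ε := lt_min (by positivity) (by
    have : 0 < F₀ - Fs + 1 := by linarith
    positivity)
  have hε1 : ε * (3 * (C + 1)) ≤ 1 := (le_div_iff₀ (by positivity)).1 (min_le_left _ _)
  have hε2 : ε * (12 * (F₀ - Fs + 1)) ≤ 1 := (le_div_iff₀ (by linarith)).1 (min_le_right _ _)
  refine ⟨1 - ε, by nlinarith, by linarith, fun x hx d y hd hy => ?_⟩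
  have hxd := sublevel_subset hx₀ hx
  obtain ⟨hyd, hdec⟩ := hp.decrease_damped hxd hd hy
  have hxF := (hp.mem_sublevel_iff hx₀ hxd).1 hx
  have hl0 : 0 ≤ localNorm f x d := Real.sqrt_nonneg _
  have hdec0 : 0 ≤ localNorm f x d ^ 2 / (2 * (1 + localNorm f x d)) := by positivity
  refine ⟨(hp.mem_sublevel_iff hx₀ hyd).2 (by linarith), ?_⟩
  suffices ε * (toRealFun f x + toRealFun g x - Fs) ≤
      localNorm f x d ^ 2 / (2 * (1 + localNorm f x d)) by linarith
  have hxs := hgap x hxd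
  rcases le_or_gt (localNorm f x d) (1 / 2) with hl | hl
  · have h1 := hp.gap_le hx₀ hm hess_ge hx hxsS (hdiff x hx)
    have h2 := hp.norm_grad_le hx₀ hm hess_ge hess_le hint hdiff hL hx hd hl
    have h3 : toRealFun f x + toRealFun g x - Fs ≤ C * localNorm f x d ^ 2 := by
      refine h1.trans ((div_le_div_of_nonneg_right h2 (by positivity)).trans (le_of_eq ?_))
      rw [hC]
      ring
    have h4 : localNorm f x d ^ 2 / 3 ≤ localNorm f x d ^ 2 / (2 * (1 + localNorm f x d)) :=
      div_le_div_of_nonneg_left (sq_nonneg _) (by positivity) (by linarith)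
    have h5 := mul_le_mul_of_nonneg_left h3 hε0.le
    have h6 := mul_le_mul_of_nonneg_right hε1 (sq_nonneg (localNorm f x d))
    have h7 := mul_nonneg hε0.le (sq_nonneg (localNorm f x d))
    linarith
  · have h4 : 1 / 12 ≤ localNorm f x d ^ 2 / (2 * (1 + localNorm f x d)) := by
      rw [le_div_iff₀ (by positivity)]
      nlinarith
    have h5 := mul_le_mul_of_nonneg_left (by linarith :
      toRealFun f x + toRealFun g x - Fs ≤ F₀ - Fs) hε0.le
    linarith

/-- A sequence of damped proximal Newton steps, whose directions are known to be proximal Newton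
directions on the sublevel set, converges linearly. -/
lemma IsCSCProblem.isGloballyLinearlyConvergent (hp : IsCSCProblem f g)
    (hx₀ : x₀ ∈ dom (f + g)) (hg : IsLipschitzDifferentiableOn g (sublevel (f + g) x₀))
    {Generated : (ℕ → E N) → Prop} (hgen : ∀ x, Generated x → x 0 = x₀ ∧
      ∀ k, x k ∈ sublevel (f + g) x₀ → ∃ d, IsProxNewtonDirection f g (x k) d ∧
        x (k + 1) = x k + (1 / (1 + localNorm f (x k) d)) • d) :
    IsGloballyLinearlyConvergent (f + g) x₀ Generated := by
  obtain ⟨xs, hmin, -⟩ := hp.existsUnique_min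
  obtain ⟨q, hq0, hq1, hstep⟩ := hp.exists_contraction hx₀ hg hmin
  refine ⟨q, hq0, hq1, fun x hx k => ?_⟩
  obtain ⟨h0, hx⟩ := hgen x hx
  have key : x k ∈ sublevel (f + g) x₀ ∧
      toRealFun f (x k) + toRealFun g (x k) - (toRealFun f xs + toRealFun g xs) ≤
        q ^ k * (toRealFun f x₀ + toRealFun g x₀ - (toRealFun f xs + toRealFun g xs)) := by
    induction k with
    | zero => exact ⟨show (f + g) (x 0) ≤ (f + g) x₀ by rw [h0], by simp [h0]⟩
    | succ k ih =>
      obtain ⟨d, hd, hxk⟩ := hx k ih.1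
      obtain ⟨h1, h2⟩ := hstep (x k) ih.1 d _ hd hxk
      refine ⟨h1, h2.trans ?_⟩
      rw [pow_succ', mul_assoc]
      exact mul_le_mul_of_nonneg_left ih.2 hq0.le
  have hinf : ⨅ y, (f + g) y = (f + g) xs := le_antisymm (iInf_le _ _) (le_iInf hmin)
  rw [hinf, hp.add_eq_coe (sublevel_subset hx₀ key.1), hp.add_eq_coe hx₀,
    hp.add_eq_coe (sublevel_subset hx₀ (hmin x₀)), ← EReal.coe_sub, ← EReal.coe_sub,
    ← EReal.coe_mul, EReal.coe_le_coe_iff]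
  exact key.2

lemma isLipschitzDifferentiableOn_zero (S : Set (E N)) :
    IsLipschitzDifferentiableOn (0 : E N → EReal) S := by
  have h0 : toRealFun (0 : E N → EReal) = fun _ => 0 := by
    funext x
    simp [toRealFun]
  have hdom : dom (0 : E N → EReal) = univ := by
    ext x
    simp [dom]
  refine ⟨by simp [hdom], fun x _ => h0 ▸ differentiableAt_const _, 0, ?_⟩
  have : grad (0 : E N → EReal) = fun _ => 0 := by
    funext x
    rw [grad, h0]
    exact gradient_fun_const x 0
  rw [this]
  exact LipschitzWith.lipschitzOnWith (LipschitzWith.const 0)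

end PDN
end

theorem corollary4p2 (N : ℕ) :
    (∀ (f g : PDN.E N → EReal) (x0 : PDN.E N),
      PDN.IsCSCProblem f g → x0 ∈ PDN.dom (f + g) →
      PDN.IsLipschitzDifferentiableOn g (PDN.sublevel (f + g) x0) →
      PDN.IsGloballyLinearlyConvergent (f + g) x0 (PDN.IsPDNSequence f g x0)) ∧
    (∀ (f : PDN.E N → EReal) (x0 : PDN.E N),
      PDN.IsCSCProblem f 0 → x0 ∈ PDN.dom f →
      PDN.IsGloballyLinearlyConvergent f x0 (PDN.IsDNSequence f x0)) := by
  refine ⟨fun f g x0 hp hx0 hg => hp.isGloballyLinearlyConvergent hx0 hg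
    fun x hx => ⟨hx.1, fun k _ => hx.2 k⟩, fun f x0 hp hx0 => ?_⟩
  have hx0' : x0 ∈ PDN.dom (f + 0) := by rwa [add_zero]
  have h := hp.isGloballyLinearlyConvergent (Generated := PDN.IsDNSequence f x0) hx0'
    (PDN.isLipschitzDifferentiableOn_zero _) fun x hx => ⟨hx.1, fun k hk => by
      have hxk := PDN.sublevel_subset hx0' hk
      exact ⟨PDN.newtonDirection f (x k), PDN.isProxNewtonDirection_newtonDirection
        hp.selfConcordant (hp.mem_dom_iff.1 hxk).1 (hp.hess_posDef _ hxk), hx.2 k⟩⟩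
  rwa [add_zero] at h
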